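/- **Setting.** Let $(X,\mathscr F,\mu,T)$ be an ergodic measure preserving system, $\mu$ a probability measure. Matrices carry the Euclidean operator norm. For $A:X\to \mathrm{Mat}_m(\mathbb R)$ put $A^{(n)}(x)=A(T^{n-1}x)\cdots A(Tx)A(x)$, $A^{(0)}=I$, and, with $\log 0=-\infty$, $$L_1(A)=\lim_{n\to\infty}\int_X \tfrac1n\log\|A^{(n)}(x)\|\,\mu(dx)\in[-\infty,\infty).$$ *Cocycles.* A space of measurable cocycles $\mathcal C$ is a class of measurable functions $A:X\to\mathrm{Mat}_m(\mathbb R)$ ($m$ not fixed) with $\|A\|\in L^\infty(\mu)$, such that $\wedge_kA\in\mathcal C$ for all $A \in \mathcal C_m$, $1\le k\le m$; here $\mathcal C_m$ is the set of $A\in\mathcal C$ with values in $\mathrm{Mat}_m(\mathbb R)$. Each $\mathcal C_m$ has a distance (functions that agree a.e. may be at distance $0$) with $\mathrm{dist}(B,A)\ge\|B-A\|_{L^\infty}$, and the maps $A\mapsto\wedge_kA$ are locally Lipschitz. $A$ is *$L^1$-bounded* if there is $C<\infty$ with $\big\|\frac1n\log\|A^{(n)}(\cdot)\|\big\|_{L^1}<C$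 for all $n\ge1$. *Observables.* Let $\Xi$ be a set of measurable functions $\xi:X\to\mathbb R$. Let $\mathscr F_N(A)$ be the algebra of sets generated by the sets $\{\|A^{(n)}\|\le c\}$ and $\{\|A^{(n)}\|\ge c\}$, $c\ge0$, $0\le n\le N$. $\Xi$ and $A$ are *compatible* if for all $N$, all $F\in\mathscr F_N(A)$ and all $\epsilon>0$ there is an integrable $\xi\in\Xi$ with $\mathbf 1_F\le\xi$ and $\int\xi\,d\mu\le\mu(F)+\epsilon$. *LDT parameters.* Deviation size functions are non-increasing functions $\delta:(0,\infty)\to(0,\infty)$; deviation set measure functions are continuous functions $\iota:(0,\infty)\to(0,\infty)$, strictly decreasing to $0$, with $\log t\lesssim\log\frac1{\iota(t)}\lesssim t$ as $t\to\infty$ and $\limsup_{t\to\infty}\phi(2t)/\phi(t)<2$, where $\phi$ is the inverse of $t\mapsto t\,\iota(t)^{-1/2}$. Let $\mathscr E$ and $\mathscr I$ be sets of functions of the first and of the second kind, $\mathscr I$ being closed under sums and under multiplication by positive constants. Let $\mathscr P$ be a set of triples $(\underline{n_0},\delta,\iota)$ with $\underline{n_0}\ge1$ an integer, $\delta\in\mathscr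 E$, $\iota\in\mathscr I$, such that for every $\epsilon>0$ some $(\underline{n_0},\delta,\iota)\in\mathscr P$ has $\delta(\underline{n_0})\le\epsilon$. Write $\delta_n=\delta(n)$, $\iota_n=\iota(n)$. An observable $\xi$ satisfies a *base-LDT* if it is integrable and for every $\epsilon>0$ there is $(\underline{n_0},\delta,\iota)\in\mathscr P$ such that for all $n\ge\underline{n_0}$ we have $\delta_n\le\epsilon$ and $$\mu\Big\{x:\Big|\tfrac1n\sum_{j=0}^{n-1}\xi(T^jx)-\int\xi\,d\mu\Big|>\delta_n\Big\}<\iota_n.$$ **Proposition 2.1 (nearly uniform upper semicontinuity).** Let $A\in\mathcal C_m$ be such that $\Xi$ and $A$ are compatible and every $\xi\in\Xi$ satisfies a base-LDT. (i) Assume that $L_1(A)>-\infty$ and that $A$ is $L^1$-bounded. For every $\epsilon>0$ there are $\delta>0$, $n_0\ge1$ and $\iota\in\mathscr I$, depending only on $A$ and $\epsilon$, such that for all $B\in\mathcal C_m$ with $\mathrm{dist}(B,A)<\delta$ and all $n\ge n_0$, $$\tfrac1n\log\|B^{(n)}(x)\|\le L_1(A)+\epsilon$$ for all $x$ outside a set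 of measure $<\iota_n$. Up to a null set, this exceptional set depends only on $A$, $\epsilon$ and $n$ (not on $B$). (ii) Assume that $L_1(A)=-\infty$. For every $t\in\mathbb R$ there are $\delta>0$, $n_0\ge1$ and $\iota\in\mathscr I$, depending only on $A$ and $t$, such that for all $B\in\mathcal C_m$ with $\mathrm{dist}(B,A)<\delta$ and all $n\ge n_0$, $$\tfrac1n\log\|B^{(n)}(x)\|\le -t$$ for all $x$ outside a set of measure $<\iota_n$. Up to a null set, this exceptional set depends only on $A$, $t$ and $n$ (not on $B$). -/

import Mathlib

open MeasureTheory Filter Topology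
open scoped ENNReal Matrix.Norms.L2Operator

/-! Throughout, matrices carry the operator norm induced by the Euclidean norm. -/

noncomputable section

namespace LyapunovCocycle

/-! ### Exterior powers of matrices -/

/-- The strictly increasing `k`-tuples in `Fin m`, inside the lexicographically ordered tuples. -/
def increasingTuples (m k : ℕ) : Finset (Lex (Fin k → Fin m)) :=
  open Classical in
  (Finset.univ : Finset (Fin k → Fin m)).filter StrictMono |>.map toLex.toEmbedding

theorem card_increasingTuples (m k : ℕ) : (increasingTuples m k).card = m.choose k := by
  classical
  unfold increasingTuples
  rw [Finset.card_map, ← Fintype.card_subtype, ← Nat.card_eq_fintype_card]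
  have e : {f : Fin k → Fin m // StrictMono f} ≃ (Fin k ↪o Fin m) :=
    { toFun := fun f => OrderEmbedding.ofStrictMono f.1 f.2
      invFun := fun f => ⟨f, f.strictMono⟩
      left_inv := fun f => rfl
      right_inv := fun f => by ext; rfl }
  rw [Nat.card_congr (e.trans Set.powersetCard.ofFinEmbEquiv), Set.powersetCard.card,
    Nat.card_eq_fintype_card, Fintype.card_fin]

/-- The `i`-th strictly increasing `k`-tuple in `Fin m`, in lexicographic order. -/
def increasingTuple (m k : ℕ) (i : Fin (m.choose k)) : Fin k → Fin m :=
  ofLex ((increasingTuples m k).orderEmbOfFin (card_increasingTuples m k) i)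

/-- The matrix of `∧ₖ g` in the basis `e_{i₁} ∧ ⋯ ∧ e_{iₖ}`, `i₁ < ⋯ < iₖ`, ordered
lexicographically: its entries are the `k × k` minors of `g`. -/
def wedge {m : ℕ} (k : ℕ) (g : Matrix (Fin m) (Fin m) ℝ) :
    Matrix (Fin (m.choose k)) (Fin (m.choose k)) ℝ :=
  Matrix.of fun i j => (g.submatrix (increasingTuple m k i) (increasingTuple m k j)).det

variable {X : Type*} [MeasurableSpace X]

/-! ### Cocycles -/

/-- A space of measurable cocycles over `(X, μ)`: for each dimension `m` a set `carrier m` of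
functions `X → Mat_m(ℝ)` with a distance on it. The distance separates functions only up to
`μ`-almost everywhere equality, as the `L^∞` distance does. -/
structure CocycleSpace (μ : Measure X) where
  carrier : ∀ m : ℕ, Set (X → Matrix (Fin m) (Fin m) ℝ)
  measurable : ∀ m, ∀ A ∈ carrier m, ∀ i j, Measurable fun x => A x i j
  bounded : ∀ m, ∀ A ∈ carrier m, eLpNorm A ∞ μ < ∞
  wedge_mem : ∀ m, ∀ A ∈ carrier m, ∀ k, 1 ≤ k → k ≤ m →
    (fun x => wedge k (A x)) ∈ carrier (m.choose k)
  /-- The distance on `carrier m`; its values off `carrier m` are irrelevant. -/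
  dist : ∀ {m : ℕ}, (X → Matrix (Fin m) (Fin m) ℝ) → (X → Matrix (Fin m) (Fin m) ℝ) → ℝ
  dist_nonneg : ∀ m, ∀ A ∈ carrier m, ∀ B ∈ carrier m, 0 ≤ dist A B
  dist_self : ∀ m, ∀ A ∈ carrier m, dist A A = 0
  dist_comm : ∀ m, ∀ A ∈ carrier m, ∀ B ∈ carrier m, dist A B = dist B A
  dist_triangle : ∀ m, ∀ A ∈ carrier m, ∀ B ∈ carrier m, ∀ D ∈ carrier m,
    dist A D ≤ dist A B + dist B D
  /-- The distance is at least as fine as the `L^∞` distance. -/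
  le_dist : ∀ m, ∀ A ∈ carrier m, ∀ B ∈ carrier m,
    eLpNorm (fun x => B x - A x) ∞ μ ≤ ENNReal.ofReal (dist B A)
  /-- The maps `A ↦ ∧ₖ A` are locally Lipschitz. -/
  wedge_lipschitz : ∀ m, ∀ A ∈ carrier m, ∀ k, 1 ≤ k → k ≤ m →
    ∃ r > 0, ∃ K : ℝ, ∀ B₁ ∈ carrier m, ∀ B₂ ∈ carrier m, dist B₁ A < r → dist B₂ A < r →
      dist (fun x => wedge k (B₁ x)) (fun x => wedge k (B₂ x)) ≤ K * dist B₁ B₂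

/-- The iterates `A⁽ⁿ⁾(x) = A(Tⁿ⁻¹x) ⋯ A(Tx) A(x)` of a cocycle. -/
def iterate (T : X → X) {m : ℕ} (A : X → Matrix (Fin m) (Fin m) ℝ) :
    ℕ → X → Matrix (Fin m) (Fin m) ℝ
  | 0, _ => 1
  | n + 1, x => A (T^[n] x) * iterate T A n x

/-- `(1/n) log ‖A⁽ⁿ⁾(x)‖ ∈ [-∞, ∞)` for `n ≥ 1`, with `log 0 = -∞`. -/
def growth (T : X → X) {m : ℕ} (A : X → Matrix (Fin m) (Fin m) ℝ) (n : ℕ) (x : X) : EReal :=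
  ENNReal.log ‖iterate T A n x‖ₑ / (n : EReal)

/-- The integral `∫ f⁺ - ∫ f⁻` of an extended real valued function, meaningful as soon as
one of the two integrals is finite. For `f = (1/n) log ‖A⁽ⁿ⁾‖` with `A` essentially bounded,
the integral of the positive part is finite. -/
def extIntegral (μ : Measure X) (f : X → EReal) : EReal :=
  ((∫⁻ x, (f x).toENNReal ∂μ : ℝ≥0∞) : EReal) - ((∫⁻ x, (-f x).toENNReal ∂μ : ℝ≥0∞) : EReal)

/-- The finite scale maximal Lyapunov exponent `∫ (1/n) log ‖A⁽ⁿ⁾(x)‖ μ(dx)`. -/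
def finiteScaleExponent (μ : Measure X) (T : X → X) {m : ℕ}
    (A : X → Matrix (Fin m) (Fin m) ℝ) (n : ℕ) : EReal :=
  extIntegral μ (growth T A n)

/-- The maximal Lyapunov exponent `L₁(A) ∈ [-∞, ∞)`, the limit of the finite scale exponents.
For measure preserving `T` and essentially bounded `A` that limit exists, by subadditivity of
`n ↦ ∫ log ‖A⁽ⁿ⁾‖`, and so is equal to the upper limit used here. -/
def topExponent (μ : Measure X) (T : X → X) {m : ℕ}
    (A : X → Matrix (Fin m) (Fin m) ℝ) : EReal :=
  limsup (finiteScaleExponent μ T A) atTop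

/-- `A` is `L¹`-bounded. (The function `(1/n) log ‖A⁽ⁿ⁾‖` may take the value `-∞`, where its
absolute value is `∞`.) -/
def IsL1Bounded (μ : Measure X) (T : X → X) {m : ℕ}
    (A : X → Matrix (Fin m) (Fin m) ℝ) : Prop :=
  ∃ C : ℝ, ∀ n : ℕ, 1 ≤ n → ∫⁻ x, (growth T A n x).abs ∂μ < ENNReal.ofReal C

/-! ### Observables -/

/-- The algebra `ℱ_N(A)` generated by the sets `{‖A⁽ⁿ⁾‖ ≤ c}` and `{‖A⁽ⁿ⁾‖ ≥ c}`,
`c ≥ 0`, `0 ≤ n ≤ N`. -/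
def cocycleAlgebra (T : X → X) {m : ℕ} (A : X → Matrix (Fin m) (Fin m) ℝ) (N : ℕ) :
    Set (Set X) :=
  generateSetAlgebra {F | ∃ n ≤ N, ∃ c : ℝ, 0 ≤ c ∧
    (F = {x | ‖iterate T A n x‖ ≤ c} ∨ F = {x | c ≤ ‖iterate T A n x‖})}

/-- The set `Ξ` of observables is compatible with the cocycle `A`. -/
def Compatible (μ : Measure X) (T : X → X) (Ξ : Set (X → ℝ)) {m : ℕ}
    (A : X → Matrix (Fin m) (Fin m) ℝ) : Prop :=
  ∀ N : ℕ, ∀ F ∈ cocycleAlgebra T A N, ∀ ε : ℝ, 0 < ε → ∃ ξ ∈ Ξ,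
    (∀ x, F.indicator (fun _ => (1 : ℝ)) x ≤ ξ x) ∧
      Integrable ξ μ ∧ ∫ x, ξ x ∂μ ≤ μ.real F + ε

/-! ### Large deviation parameters. Only the values on `(0, ∞)` of these functions matter. -/

/-- Deviation size functions. -/
def IsDeviationSize (dev : ℝ → ℝ) : Prop :=
  (∀ t, 0 < t → 0 < dev t) ∧ AntitoneOn dev (Set.Ioi 0)

/-- The map `ψ(t) = t ι(t)^{-1/2}`. -/
def psi (mes : ℝ → ℝ) (t : ℝ) : ℝ := t * (mes t) ^ (-(1 / 2) : ℝ)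

/-- The inverse `φ` of `ψ : (0, ∞) → (0, ∞)`. -/
def phi (mes : ℝ → ℝ) : ℝ → ℝ := Function.invFunOn (psi mes) (Set.Ioi 0)

/-- Deviation set measure functions: positive, continuous and strictly decreasing to `0`, at
least like a power and at most like an exponential, with `limsup φ(2t)/φ(t) < 2`. -/
structure IsDeviationMeasure (mes : ℝ → ℝ) : Prop where
  pos : ∀ t, 0 < t → 0 < mes t
  continuousOn : ContinuousOn mes (Set.Ioi 0)
  strictAntiOn : StrictAntiOn mes (Set.Ioi 0)
  tendsto_zero : Tendsto mes atTop (𝓝 0)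
  log_le : (fun t => Real.log t) =O[atTop] fun t => Real.log (1 / mes t)
  le_linear : (fun t => Real.log (1 / mes t)) =O[atTop] fun t => t
  phi_growth : limsup (fun t => ((phi mes (2 * t) / phi mes t : ℝ) : EReal)) atTop < 2

/-- A triple `(n₀, dev, mes)`. -/
structure LDTParam where
  n₀ : ℕ
  dev : ℝ → ℝ
  mes : ℝ → ℝ

/-- A set `params` of LDT parameters with its spaces of deviation functions. -/
structure LDTSetting where
  /-- The space `ℰ` of deviation size functions. -/
  devFuns : Set (ℝ → ℝ)
  /-- The space `ℐ` of deviation set measure functions. -/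
  mesFuns : Set (ℝ → ℝ)
  /-- The set `𝒫` of LDT parameters. -/
  params : Set LDTParam
  isDeviationSize : ∀ dev ∈ devFuns, IsDeviationSize dev
  isDeviationMeasure : ∀ mes ∈ mesFuns, IsDeviationMeasure mes
  smul_mem : ∀ a : ℝ, 0 < a → ∀ mes ∈ mesFuns, (fun t => a * mes t) ∈ mesFuns
  add_mem : ∀ mes₁ ∈ mesFuns, ∀ mes₂ ∈ mesFuns, (fun t => mes₁ t + mes₂ t) ∈ mesFuns
  params_mem : ∀ p ∈ params, 1 ≤ p.n₀ ∧ p.dev ∈ devFuns ∧ p.mes ∈ mesFuns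
  exists_small : ∀ ε : ℝ, 0 < ε → ∃ p ∈ params, p.dev p.n₀ ≤ ε

/-- The observable `ξ` satisfies a base-LDT estimate with parameters in `S.params`. -/
def BaseLDT (μ : Measure X) (T : X → X) (S : LDTSetting) (ξ : X → ℝ) : Prop :=
  Integrable ξ μ ∧ ∀ ε : ℝ, 0 < ε → ∃ p ∈ S.params, ∀ n : ℕ, p.n₀ ≤ n → p.dev n ≤ ε ∧
    μ {x | p.dev n < |birkhoffAverage ℝ T ξ n x - ∫ y, ξ y ∂μ|} < ENNReal.ofReal (p.mes n)

end LyapunovCocycle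

end

/-!
The proof compares all nearby cocycles with one truncated observable of `A` at a fixed scale, so
that neither a subadditive nor an additive pointwise ergodic theorem is needed.

Let `a` be a real number above `L₁(A)`, which may be `-∞`. Some finite scale exponent is below
`a`, say the one at scale `N`, and by monotone convergence this persists under truncation: for
some `r > 0` the function `g = log max(‖A⁽ᴺ⁾‖, r)` has `∫ g < N a`
(`exists_integral_log_max_lt`). Four facts then give `log ‖B⁽ⁿ⁾‖ ≤ n a` for large `n`.

* Submultiplicativity, averaged over the `N` ways to cut an orbit segment into blocks of length
  `N`, bounds `N log ‖B⁽ⁿ⁾(x)‖` by a constant plus the Birkhoff sum of `log max(‖B⁽ᴺ⁾‖, r)`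
  (`mul_log_norm_iterate_le`).
* The truncated logarithm is Lipschitz, so for `B` close to `A` in `L^∞` the function
  `log max(‖B⁽ᴺ⁾‖, r)` exceeds `g` by little almost everywhere
  (`norm_iterate_sub_le`, `log_max_le_log_max_add`).
* As `g` is bounded, it is uniformly close to a constant plus a finite combination, with positive
  coefficients, of indicators of sets `{‖A⁽ᴺ⁾‖ ≥ c}` (`log_max_layers`). Compatibility bounds
  these indicators from above by observables with almost the same integrals.
* The base-LDT estimates of these finitely many observables bound the Birkhoff sums of `g`
  by `n (∫ g + small)` off a small set (`exists_birkhoffSum_log_max_le`).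

The exceptional set comes from the observables, hence depends only on `A`; the cocycle `B`
contributes only the null set of points whose orbit meets `{‖B - A‖ > dist B A}`.
-/

namespace LyapunovCocycle

/-! ### Iterates along a single orbit -/

section Orbit

variable {X : Type*} {T : X → X} {m : ℕ} {A B : X → Matrix (Fin m) (Fin m) ℝ} {x : X} {M : ℝ}

theorem iterate_add (T : X → X) (A : X → Matrix (Fin m) (Fin m) ℝ) (n k : ℕ) (x : X) :
    iterate T A (n + k) x = iterate T A k (T^[n] x) * iterate T A n x := by
  induction k with
  | zero => simp [iterate]
  | succ k ih =>
    rw [← add_assoc, iterate, ih, iterate, mul_assoc, ← Function.iterate_add_apply, add_comm k n]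

/-- The norm of the identity matrix is `1`, except that it is `0` in dimension `0`. -/
theorem norm_one_matrix_le (m : ℕ) : ‖(1 : Matrix (Fin m) (Fin m) ℝ)‖ ≤ 1 := by
  rcases isEmpty_or_nonempty (Fin m) with h | h
  · rw [Subsingleton.elim (1 : Matrix (Fin m) (Fin m) ℝ) 0, norm_zero]
    exact zero_le_one
  · exact (CStarRing.norm_one (E := Matrix (Fin m) (Fin m) ℝ)).le

theorem norm_iterate_le (hM : 0 ≤ M) (hA : ∀ j, ‖A (T^[j] x)‖ ≤ M) (n : ℕ) :
    ‖iterate T A n x‖ ≤ M ^ n := by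
  induction n with
  | zero => simpa [iterate] using norm_one_matrix_le m
  | succ n ih =>
    rw [iterate, pow_succ']
    exact (norm_mul_le _ _).trans (mul_le_mul (hA n) ih (norm_nonneg _) hM)

theorem norm_iterate_sub_le {ρ : ℝ} (hM : 1 ≤ M) (hA : ∀ j, ‖A (T^[j] x)‖ ≤ M)
    (hB : ∀ j, ‖B (T^[j] x)‖ ≤ M) (hρ : ∀ j, ‖B (T^[j] x) - A (T^[j] x)‖ ≤ ρ) (n : ℕ) :
    ‖iterate T B n x - iterate T A n x‖ ≤ n * M ^ n * ρ := by
  have hM0 : 0 ≤ M := zero_le_one.trans hM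
  have hρ0 : 0 ≤ ρ := (norm_nonneg _).trans (hρ 0)
  induction n with
  | zero => simp [iterate]
  | succ n ih =>
    have hsplit : iterate T B (n + 1) x - iterate T A (n + 1) x =
        B (T^[n] x) * (iterate T B n x - iterate T A n x) +
          (B (T^[n] x) - A (T^[n] x)) * iterate T A n x := by
      simp only [iterate]
      noncomm_ring
    rw [hsplit]
    calc _ ≤ M * (n * M ^ n * ρ) + ρ * M ^ n := by
          refine (norm_add_le _ _).trans (add_le_add ?_ ?_)
          · exact (norm_mul_le _ _).trans (mul_le_mul (hB n) ih (norm_nonneg _) hM0)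
          · exact (norm_mul_le _ _).trans
              (mul_le_mul (hρ n) (norm_iterate_le hM0 hA n) (norm_nonneg _) hρ0)
      _ ≤ M * (n * M ^ n * ρ) + M * (ρ * M ^ n) := by
          exact add_le_add le_rfl (le_mul_of_one_le_left (by positivity) hM)
      _ = _ := by push_cast; ring

/-- The product of the norms of `N` consecutive iterates grows from `n` to `n + 1` by a factor
of at most `‖B⁽ᴺ⁾(Tⁿx)‖`, since only its first and last factors are exchanged. This replaces
the averaging, over the `N` possible starting points, of the decompositions of an orbit
segment into blocks of length `N`. -/
theorem prod_norm_iterate_le (hM : 1 ≤ M) (hB : ∀ j, ‖B (T^[j] x)‖ ≤ M) {N : ℕ}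
    (hN : 1 ≤ N) (n : ℕ) :
    ∏ i ∈ Finset.range N, ‖iterate T B (n + i) x‖ ≤
      M ^ (N * N) * ∏ j ∈ Finset.range n, ‖iterate T B N (T^[j] x)‖ := by
  have hM0 : 0 ≤ M := zero_le_one.trans hM
  induction n with
  | zero =>
    simp only [zero_add, Finset.range_zero, Finset.prod_empty, mul_one, pow_mul]
    calc ∏ i ∈ Finset.range N, ‖iterate T B i x‖ ≤ ∏ _i ∈ Finset.range N, M ^ N :=
          Finset.prod_le_prod (fun _ _ => norm_nonneg _) fun i hi =>
            (norm_iterate_le hM0 hB i).trans (pow_le_pow_right₀ hM (Finset.mem_range.1 hi).le)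
      _ = (M ^ N) ^ N := by simp
  | succ n ih =>
    obtain ⟨N, rfl⟩ := Nat.exists_eq_add_of_le' hN
    rw [Finset.prod_range_succ (fun j => ‖iterate T B (N + 1) (T^[j] x)‖), ← mul_assoc]
    calc ∏ i ∈ Finset.range (N + 1), ‖iterate T B (n + 1 + i) x‖
        = (∏ i ∈ Finset.range N, ‖iterate T B (n + (i + 1)) x‖) *
            ‖iterate T B (n + (N + 1)) x‖ := by
          rw [Finset.prod_range_succ]
          simp only [add_comm, add_left_comm]
      _ ≤ (∏ i ∈ Finset.range N, ‖iterate T B (n + (i + 1)) x‖) *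
            (‖iterate T B n x‖ * ‖iterate T B (N + 1) (T^[n] x)‖) := by
          rw [iterate_add T B n (N + 1), mul_comm ‖iterate T B n x‖]
          exact mul_le_mul_of_nonneg_left (norm_mul_le _ _)
            (Finset.prod_nonneg fun _ _ => norm_nonneg _)
      _ = (∏ i ∈ Finset.range (N + 1), ‖iterate T B (n + i) x‖) *
            ‖iterate T B (N + 1) (T^[n] x)‖ := by
          rw [Finset.prod_range_succ', mul_assoc, add_zero]
      _ ≤ _ := mul_le_mul_of_nonneg_right ih (norm_nonneg _)

theorem norm_iterate_pow_le (hM : 1 ≤ M) (hB : ∀ j, ‖B (T^[j] x)‖ ≤ M) {N : ℕ}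
    (hN : 1 ≤ N) (n : ℕ) :
    ‖iterate T B (n + N) x‖ ^ N ≤
      M ^ (2 * (N * N)) * ∏ j ∈ Finset.range n, ‖iterate T B N (T^[j] x)‖ := by
  have hM0 : 0 ≤ M := zero_le_one.trans hM
  calc ‖iterate T B (n + N) x‖ ^ N
      = ∏ _i ∈ Finset.range N, ‖iterate T B (n + N) x‖ := by simp
    _ ≤ ∏ i ∈ Finset.range N, M ^ N * ‖iterate T B (n + i) x‖ := by
        refine Finset.prod_le_prod (fun _ _ => norm_nonneg _) fun i hi => ?_
        have hi := Finset.mem_range.1 hi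
        have hsum : n + N = n + i + (N - i) := by omega
        rw [hsum, iterate_add]
        refine (norm_mul_le _ _).trans (mul_le_mul_of_nonneg_right ?_ (norm_nonneg _))
        refine (norm_iterate_le hM0 (fun j => ?_) (N - i)).trans
          (pow_le_pow_right₀ hM (Nat.sub_le _ _))
        rw [← Function.iterate_add_apply]
        exact hB _
    _ = M ^ (N * N) * ∏ i ∈ Finset.range N, ‖iterate T B (n + i) x‖ := by
        rw [Finset.prod_mul_distrib, Finset.prod_const, Finset.card_range, ← pow_mul]
    _ ≤ M ^ (N * N) * (M ^ (N * N) * ∏ j ∈ Finset.range n, ‖iterate T B N (T^[j] x)‖) :=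
        mul_le_mul_of_nonneg_left (prod_norm_iterate_le hM hB hN n) (by positivity)
    _ = _ := by rw [← mul_assoc, ← pow_add, two_mul]

/-- `N log ‖B⁽ⁿ⁾(x)‖` is bounded, up to a constant independent of `n`, by the Birkhoff sum of
the truncated function `log max(‖B⁽ᴺ⁾‖, r)`. -/
theorem mul_log_norm_iterate_le {r : ℝ} (hr : 0 < r) (hM : 1 ≤ M)
    (hB : ∀ j, ‖B (T^[j] x)‖ ≤ M) {N n : ℕ} (hN : 1 ≤ N) (hn : N ≤ n) (h0 : ‖iterate T B n x‖ ≠ 0) :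
    N * Real.log ‖iterate T B n x‖ ≤ 2 * (N * N) * Real.log M - N * Real.log r +
      ∑ j ∈ Finset.range n, Real.log (max ‖iterate T B N (T^[j] x)‖ r) := by
  have hM0 : 0 < M := zero_lt_one.trans_le hM
  obtain ⟨k, rfl⟩ := Nat.exists_eq_add_of_le' hn
  have hmax : ∀ y, 0 < max ‖iterate T B N y‖ r := fun y => lt_max_of_lt_right hr
  have hle : ‖iterate T B (k + N) x‖ ^ N ≤ M ^ (2 * (N * N)) *
      ∏ j ∈ Finset.range k, max ‖iterate T B N (T^[j] x)‖ r :=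
    (norm_iterate_pow_le hM hB hN k).trans (mul_le_mul_of_nonneg_left
      (Finset.prod_le_prod (fun _ _ => norm_nonneg _) fun _ _ => le_max_left _ _)
      (by positivity))
  have hlog := Real.log_le_log (by positivity) hle
  rw [Real.log_pow, Real.log_mul (by positivity) (Finset.prod_pos fun _ _ => hmax _).ne',
    Real.log_pow, Real.log_prod fun _ _ => (hmax _).ne'] at hlog
  -- The `N` terms missing at the end of the orbit segment are each at least `log r`.
  have htail : N * Real.log r ≤
      ∑ j ∈ Finset.range N, Real.log (max ‖iterate T B N (T^[k + j] x)‖ r) := by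
    have := Finset.card_nsmul_le_sum (Finset.range N)
      (fun j => Real.log (max ‖iterate T B N (T^[k + j] x)‖ r)) (Real.log r)
      fun j _ => Real.log_le_log hr (le_max_right _ _)
    simpa using this
  rw [Finset.sum_range_add]
  push_cast at hlog ⊢
  linarith

end Orbit

theorem growth_le_of_log_le {X : Type*} {T : X → X} {m : ℕ} {B : X → Matrix (Fin m) (Fin m) ℝ}
    {x : X} {n : ℕ} (hn : 1 ≤ n) {a : ℝ}
    (h : ‖iterate T B n x‖ ≠ 0 → Real.log ‖iterate T B n x‖ ≤ n * a) :
    growth T B n x ≤ (a : EReal) := by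
  have hn0 : (0 : EReal) < n := by exact_mod_cast hn
  rw [growth, EReal.div_le_iff_le_mul hn0 (EReal.natCast_ne_top n), ← ofReal_norm]
  by_cases h0 : ‖iterate T B n x‖ = 0
  · simp [h0]
  · rw [ENNReal.log_ofReal_of_pos (lt_of_le_of_ne (norm_nonneg _) (Ne.symm h0))]
    exact_mod_cast h h0

theorem setOf_le_norm_iterate_mem_cocycleAlgebra {X : Type*} (T : X → X) {m : ℕ}
    (A : X → Matrix (Fin m) (Fin m) ℝ) (N : ℕ) {c : ℝ} (hc : 0 ≤ c) :
    {x | c ≤ ‖iterate T A N x‖} ∈ cocycleAlgebra T A N :=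
  generateSetAlgebra.base _ ⟨N, le_rfl, c, hc, Or.inr rfl⟩

/-! ### The truncated logarithm -/

/-- A uniform bound for the effect of a perturbation on the truncated logarithm. -/
theorem log_max_le_log_max_add {r u v ρ : ℝ} (hr : 0 < r) (h : v ≤ u + ρ) (hρ : 0 ≤ ρ) :
    Real.log (max v r) ≤ Real.log (max u r) + ρ / r := by
  have hu : 0 < max u r := lt_max_of_lt_right hr
  have hle : max v r ≤ max u r * (1 + ρ / r) := by
    have h1 : ρ ≤ max u r * (ρ / r) := by
      rw [mul_div_assoc', le_div_iff₀ hr, mul_comm]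
      exact mul_le_mul_of_nonneg_right (le_max_right _ _) hρ
    have h2 : max v r ≤ max u r + ρ :=
      max_le (h.trans (by gcongr; exact le_max_left _ _))
        ((le_max_right u r).trans (le_add_of_nonneg_right hρ))
    linarith
  have hpos : 0 < 1 + ρ / r := by positivity
  calc _ ≤ Real.log (max u r * (1 + ρ / r)) := Real.log_le_log (lt_max_of_lt_right hr) hle
    _ = Real.log (max u r) + Real.log (1 + ρ / r) := Real.log_mul hu.ne' hpos.ne'
    _ ≤ _ := by linarith [Real.log_le_sub_one_of_pos hpos]

/-- A layer cake decomposition with layers of height `η`: counting the levels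
`log r + (i + 1) η` below `log max(u, r)` recovers `log max(u, r)` with an error of at
most `η`. -/
theorem log_max_layers {r η u : ℝ} (hr : 0 < r) (hη : 0 < η) {k : ℕ}
    (hk : Real.log (max u r) ≤ Real.log r + η * k) :
    Real.log r + η * ∑ i ∈ Finset.range k,
        (if r * Real.exp ((i + 1) * η) ≤ u then (1 : ℝ) else 0) ≤ Real.log (max u r) ∧
      Real.log (max u r) ≤ Real.log r + η + η * ∑ i ∈ Finset.range k,
        (if r * Real.exp ((i + 1) * η) ≤ u then (1 : ℝ) else 0) := by
  set h : ℝ := (Real.log (max u r) - Real.log r) / η with hh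
  have hlog : Real.log (max u r) = Real.log r + η * h := by
    rw [hh]; field_simp; ring
  have h0 : 0 ≤ h := div_nonneg (sub_nonneg.2 (Real.log_le_log hr (le_max_right _ _))) hη.le
  have hhk : h ≤ k := by
    rw [hlog] at hk
    exact le_of_mul_le_mul_left (by linarith) hη
  have hiff : ∀ i : ℕ, r * Real.exp ((i + 1) * η) ≤ u ↔ i < ⌊h⌋₊ := by
    intro i
    have hlt : r < r * Real.exp ((i + 1) * η) :=
      lt_mul_of_one_lt_right hr (Real.one_lt_exp_iff.2 (by positivity))
    have h1 : r * Real.exp ((i + 1) * η) ≤ u ↔ r * Real.exp ((i + 1) * η) ≤ max u r := by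
      rw [le_max_iff]
      exact ⟨Or.inl, fun h => h.resolve_right (not_le.2 hlt)⟩
    rw [h1, ← Nat.succ_le_iff, Nat.le_floor_iff h0, ← Real.log_le_log_iff (by positivity)
      (lt_max_of_lt_right hr), Real.log_mul hr.ne' (Real.exp_pos _).ne', Real.log_exp, hlog,
      add_le_add_iff_left, mul_comm, mul_le_mul_iff_right₀ hη, Nat.cast_succ]
  have hsum : ∑ i ∈ Finset.range k,
      (if r * Real.exp ((i + 1) * η) ≤ u then (1 : ℝ) else 0) = ⌊h⌋₊ := by
    simp only [hiff]
    rw [Finset.sum_boole]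
    have hfilter : (Finset.range k).filter (· < ⌊h⌋₊) = Finset.range ⌊h⌋₊ := by
      ext i
      have : ⌊h⌋₊ ≤ k := Nat.floor_le_of_le hhk
      simp only [Finset.mem_filter, Finset.mem_range]
      omega
    rw [hfilter, Finset.card_range]
  rw [hsum, hlog]
  have h1 := mul_le_mul_of_nonneg_left (Nat.floor_le h0) hη.le
  have h2 := mul_le_mul_of_nonneg_left (Nat.lt_floor_add_one h).le hη.le
  constructor <;> linarith

variable {X : Type*} [MeasurableSpace X]

/-! ### Measurability and integrals -/

theorem measurable_matrix_norm {m : ℕ} {F : X → Matrix (Fin m) (Fin m) ℝ}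
    (hF : ∀ i j, Measurable fun x => F x i j) : Measurable fun x => ‖F x‖ := by
  have hcont : Continuous fun f : Fin m → Fin m → ℝ => ‖Matrix.of f‖ :=
    continuous_norm.comp (continuous_id : Continuous fun f : Fin m → Fin m → ℝ => f)
  exact hcont.measurable.comp (measurable_pi_lambda _ fun i => measurable_pi_lambda _ (hF i))

theorem measurable_norm_iterate {T : X → X} (hT : Measurable T) {m : ℕ}
    {A : X → Matrix (Fin m) (Fin m) ℝ} (hA : ∀ i j, Measurable fun x => A x i j) (n : ℕ) :
    Measurable fun x => ‖iterate T A n x‖ := by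
  refine measurable_matrix_norm ?_
  induction n with
  | zero => exact fun i j => measurable_const
  | succ n ih =>
    intro i j
    simp only [iterate, Matrix.mul_apply]
    exact Finset.measurable_sum _ fun l _ => ((hA i l).comp (hT.iterate n)).mul (ih l j)

theorem ae_forall_iterate {μ : Measure X} {T : X → X} (hT : MeasurePreserving T μ μ)
    {p : X → Prop} (h : ∀ᵐ x ∂μ, p x) : ∀ᵐ x ∂μ, ∀ j, p (T^[j] x) :=
  ae_all_iff.2 fun j => (hT.iterate j).quasiMeasurePreserving.ae h

theorem ae_norm_le_of_eLpNorm_top_le {μ : Measure X} {m : ℕ} {F : X → Matrix (Fin m) (Fin m) ℝ}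
    {c : ℝ} (hc : 0 ≤ c) (h : eLpNorm F ∞ μ ≤ ENNReal.ofReal c) : ∀ᵐ x ∂μ, ‖F x‖ ≤ c := by
  rw [eLpNorm_exponent_top] at h
  filter_upwards [ae_le_eLpNormEssSup (f := F) (μ := μ)] with x hx
  have := hx.trans h
  rwa [← ofReal_norm, ENNReal.ofReal_le_ofReal_iff hc] at this

/-- The positive part of `(1/N) log u`, in terms of the truncation at height `-j`. -/
theorem toENNReal_log_div {u : ℝ} (hu : 0 ≤ u) {N : ℕ} (hN : 1 ≤ N) (j : ℕ) :
    (ENNReal.log (ENNReal.ofReal u) / (N : EReal)).toENNReal =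
      ENNReal.ofReal (Real.log (max u (Real.exp (-(N * j)))) / N) := by
  have hN0 : (0 : ℝ) < N := by exact_mod_cast hN
  have hN' : (0 : EReal) < N := by exact_mod_cast hN
  rcases hu.eq_or_lt with rfl | hu
  · rw [ENNReal.ofReal_zero, ENNReal.log_zero, max_eq_right (Real.exp_pos _).le, Real.log_exp,
      EReal.bot_div_of_pos_ne_top hN' (EReal.natCast_ne_top N), ENNReal.ofReal_of_nonpos]
    · simp
    · rw [neg_div]
      exact neg_nonpos.2 (by positivity)
  · have hcast : ENNReal.log (ENNReal.ofReal u) / (N : EReal) = ((Real.log u / N : ℝ) : EReal) := by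
      rw [ENNReal.log_ofReal_of_pos hu, EReal.coe_div]
      rfl
    rw [hcast, EReal.toENNReal_of_ne_top (EReal.coe_ne_top _), EReal.toReal_coe]
    rcases le_total (Real.exp (-(N * j))) u with h | h
    · rw [max_eq_left h]
    · rw [max_eq_right h, Real.log_exp, ENNReal.ofReal_of_nonpos, ENNReal.ofReal_of_nonpos]
      · rw [neg_div]
        exact neg_nonpos.2 (by positivity)
      · refine div_nonpos_of_nonpos_of_nonneg (Real.log_nonpos hu.le (h.trans ?_)) hN0.le
        exact Real.exp_le_one_iff.2 (neg_nonpos.2 (by positivity))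

/-- The negative part of `(1/N) log u`, cut off at `j`, in terms of the truncation at height
`-j`. -/
theorem toENNReal_neg_log_div_inf {u : ℝ} (hu : 0 ≤ u) {N : ℕ} (hN : 1 ≤ N) (j : ℕ) :
    (-(ENNReal.log (ENNReal.ofReal u) / (N : EReal))).toENNReal ⊓ (j : ℝ≥0∞) =
      ENNReal.ofReal (-(Real.log (max u (Real.exp (-(N * j)))) / N)) := by
  have hN0 : (0 : ℝ) < N := by exact_mod_cast hN
  have hN' : (0 : EReal) < N := by exact_mod_cast hN
  have hj : -(-((N : ℝ) * j) / N) = j := by field_simp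
  rcases hu.eq_or_lt with rfl | hu
  · rw [ENNReal.ofReal_zero, ENNReal.log_zero, max_eq_right (Real.exp_pos _).le, Real.log_exp,
      EReal.bot_div_of_pos_ne_top hN' (EReal.natCast_ne_top N), hj]
    simp
  · have hcast : ENNReal.log (ENNReal.ofReal u) / (N : EReal) = ((Real.log u / N : ℝ) : EReal) := by
      rw [ENNReal.log_ofReal_of_pos hu, EReal.coe_div]
      rfl
    rw [hcast, ← EReal.coe_neg, EReal.toENNReal_of_ne_top (EReal.coe_ne_top _), EReal.toReal_coe,
      ← ENNReal.ofReal_natCast j]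
    rcases le_total (Real.exp (-(N * j))) u with h | h
    · rw [max_eq_left h, inf_eq_left]
      refine ENNReal.ofReal_le_ofReal ?_
      rw [← hj]
      have := (Real.le_log_iff_exp_le hu).2 h
      gcongr
    · rw [max_eq_right h, Real.log_exp, hj, inf_eq_right]
      refine ENNReal.ofReal_le_ofReal ?_
      rw [← hj]
      have := (Real.log_le_iff_le_exp hu).2 h
      gcongr

variable {μ : Measure X}

theorem integrable_log_max [IsFiniteMeasure μ] {u : X → ℝ} (hu : Measurable u) {b r : ℝ}
    (hr : 0 < r) (hub : ∀ᵐ x ∂μ, u x ≤ b) : Integrable (fun x => Real.log (max (u x) r)) μ := by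
  refine Integrable.of_mem_Icc (Real.log r) (Real.log (max b r))
    (Real.measurable_log.comp (hu.max measurable_const)).aemeasurable ?_
  filter_upwards [hub] with x hx
  exact ⟨Real.log_le_log hr (le_max_right _ _),
    Real.log_le_log (lt_max_of_lt_right hr) (max_le_max_right r hx)⟩

/-- An upper bound for the finite scale exponent, which may be `-∞`, persists when
`log ‖A⁽ᴺ⁾‖` is truncated from below at a sufficiently low level, by monotone convergence of
the negative parts. -/
theorem exists_integral_log_max_lt [IsFiniteMeasure μ] {T : X → X} {m N : ℕ} (hN : 1 ≤ N)
    {A : X → Matrix (Fin m) (Fin m) ℝ} (hmeas : Measurable fun x => ‖iterate T A N x‖) {b : ℝ}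
    (hb : ∀ᵐ x ∂μ, ‖iterate T A N x‖ ≤ b) {a : ℝ} (ha : finiteScaleExponent μ T A N < a) :
    ∃ r : ℝ, 0 < r ∧ ∫ x, Real.log (max ‖iterate T A N x‖ r) ∂μ < N * a := by
  have hN0 : (0 : ℝ) < N := by exact_mod_cast hN
  set g : ℕ → X → ℝ := fun j x =>
    Real.log (max ‖iterate T A N x‖ (Real.exp (-(N * j)))) / N with hg
  have hgi : ∀ j, Integrable (g j) μ := fun j =>
    (integrable_log_max hmeas (Real.exp_pos _) hb).div_const _
  have hgm : ∀ j, Measurable (g j) := fun j =>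
    (Real.measurable_log.comp (hmeas.max measurable_const)).div_const _
  have hpos : ∀ j x, (growth T A N x).toENNReal = ENNReal.ofReal (g j x) := fun j x => by
    rw [growth, ← ofReal_norm]
    exact toENNReal_log_div (norm_nonneg _) hN j
  have hneg : ∀ (j : ℕ) x, (-growth T A N x).toENNReal ⊓ (j : ℝ≥0∞) = ENNReal.ofReal (-g j x) :=
    fun j x => by
      rw [growth, ← ofReal_norm]
      exact toENNReal_neg_log_div_inf (norm_nonneg _) hN j
  have hP : ∀ j, ∫⁻ x, (growth T A N x).toENNReal ∂μ = ∫⁻ x, ENNReal.ofReal (g j x) ∂μ :=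
    fun j => lintegral_congr (hpos j)
  have hPtop : ∫⁻ x, (growth T A N x).toENNReal ∂μ ≠ ∞ := by
    rw [hP 0]
    exact (hgi 0).lintegral_lt_top.ne
  have hQ : ∫⁻ x, (-growth T A N x).toENNReal ∂μ = ⨆ j, ∫⁻ x, ENNReal.ofReal (-g j x) ∂μ := by
    have hm : ∀ j, Measurable fun x => ENNReal.ofReal (-g j x) := fun j =>
      (hgm j).neg.ennreal_ofReal
    rw [← lintegral_iSup hm]
    · refine lintegral_congr fun x => ?_
      simp_rw [← hneg]
      rw [← inf_iSup_eq, ENNReal.iSup_natCast, inf_top_eq]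
    · intro i j hij x
      simp only [← hneg]
      exact inf_le_inf_left _ (by exact_mod_cast hij)
  by_contra! hcon
  refine ha.not_ge ?_
  set P := ∫⁻ x, (growth T A N x).toENNReal ∂μ with hPdef
  have hQj : ∀ j, (∫⁻ x, ENNReal.ofReal (-g j x) ∂μ).toReal ≤ P.toReal - a := fun j => by
    have hint := integral_eq_lintegral_pos_part_sub_lintegral_neg_part (hgi j)
    have hdiv : ∫ x, g j x ∂μ =
        (∫ x, Real.log (max ‖iterate T A N x‖ (Real.exp (-(N * j)))) ∂μ) / N :=
      integral_div _ _
    have h1 := hcon _ (Real.exp_pos (-(N * j)))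
    rw [mul_comm, ← le_div_iff₀ hN0, ← hdiv, hint, ← hP j] at h1
    linarith
  have hnn : 0 ≤ P.toReal - a := ENNReal.toReal_nonneg.trans (hQj 0)
  have hQle : ∫⁻ x, (-growth T A N x).toENNReal ∂μ ≤ ENNReal.ofReal (P.toReal - a) := by
    rw [hQ]
    refine iSup_le fun j => ?_
    have hfin : ∫⁻ x, ENNReal.ofReal (-g j x) ∂μ ≠ ∞ := (hgi j).neg.lintegral_lt_top.ne
    rw [← ENNReal.ofReal_toReal hfin]
    exact ENNReal.ofReal_le_ofReal (hQj j)
  have hQtop : ∫⁻ x, (-growth T A N x).toENNReal ∂μ ≠ ∞ :=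
    ne_top_of_le_ne_top ENNReal.ofReal_ne_top hQle
  have hQr := ENNReal.toReal_mono ENNReal.ofReal_ne_top hQle
  rw [ENNReal.toReal_ofReal hnn] at hQr
  rw [finiteScaleExponent, extIntegral, ← hPdef, ← EReal.coe_ennreal_toReal hPtop,
    ← EReal.coe_ennreal_toReal hQtop, ← EReal.coe_sub]
  exact_mod_cast (by linarith)

theorem topExponent_lt_top_of_isL1Bounded {T : X → X} {m : ℕ}
    {A : X → Matrix (Fin m) (Fin m) ℝ} (h : IsL1Bounded μ T A) : topExponent μ T A < ⊤ := by
  obtain ⟨C, hC⟩ := h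
  refine lt_of_le_of_lt (limsup_le_of_le (by isBoundedDefault)
    (a := ((ENNReal.ofReal C : ℝ≥0∞) : EReal)) ?_) (by simp)
  filter_upwards [eventually_ge_atTop 1] with n hn
  rw [finiteScaleExponent, extIntegral]
  rw [sub_eq_add_neg]
  refine (add_le_of_nonpos_right (EReal.neg_le_zero.2 (EReal.coe_ennreal_nonneg _))).trans ?_
  refine EReal.coe_ennreal_le_coe_ennreal_iff.2 ((lintegral_mono fun x => ?_).trans (hC n hn).le)
  induction growth T A n x with
  | bot => simp
  | top => simp
  | coe y =>
    rw [EReal.toENNReal_of_ne_top (EReal.coe_ne_top _), EReal.toReal_coe, EReal.abs_def]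
    exact ENNReal.ofReal_le_ofReal (le_abs_self y)

variable {T : X → X}

/-! ### Large deviations for finitely many observables -/

/-- The base-LDT estimates of finitely many observables hold simultaneously, off a set whose
measure is controlled by a single deviation set measure function, by additivity of `mesFuns`. -/
theorem exists_birkhoffSum_le_of_baseLDT {S : LDTSetting} {ι : Type*} (s : Finset ι)
    {ξ : ι → X → ℝ} (h : ∀ i ∈ s, BaseLDT μ T S (ξ i)) {ε : ℝ} (hε : 0 < ε) :
    ∃ n₀ : ℕ, ∃ mes ∈ S.mesFuns, ∃ E : ℕ → Set X, ∀ n, 1 ≤ n → n₀ ≤ n →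
      μ (E n) < ENNReal.ofReal (mes n) ∧
        ∀ x ∉ E n, ∀ i ∈ s, birkhoffSum T (ξ i) n x ≤ n * (∫ y, ξ i y ∂μ + ε) := by
  classical
  induction s using Finset.induction_on with
  | empty =>
    obtain ⟨p, hp, -⟩ := S.exists_small 1 one_pos
    have hmes := (S.params_mem p hp).2.2
    refine ⟨1, p.mes, hmes, fun _ => ∅, fun n hn _ => ⟨?_, by simp⟩⟩
    rw [measure_empty, ENNReal.ofReal_pos]
    exact (S.isDeviationMeasure _ hmes).pos _ (by exact_mod_cast hn)
  | insert i s _ ih =>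
    obtain ⟨n₁, mes, hmes, E, hE⟩ := ih fun j hj => h j (Finset.mem_insert_of_mem hj)
    obtain ⟨p, hp, hpn⟩ := (h i (Finset.mem_insert_self i s)).2 ε hε
    have hpmes := (S.params_mem p hp).2.2
    refine ⟨max n₁ p.n₀, _, S.add_mem _ hmes _ hpmes, fun n => E n ∪
      {x | p.dev n < |birkhoffAverage ℝ T (ξ i) n x - ∫ y, ξ i y ∂μ|}, fun n hn hn' => ?_⟩
    obtain ⟨h1, h2⟩ := hE n hn ((le_max_left _ _).trans hn')
    obtain ⟨h3, h4⟩ := hpn n ((le_max_right _ _).trans hn')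
    have hn0 : (0 : ℝ) < n := by exact_mod_cast hn
    refine ⟨?_, fun x hx j hj => ?_⟩
    · rw [ENNReal.ofReal_add ((S.isDeviationMeasure _ hmes).pos _ hn0).le
        ((S.isDeviationMeasure _ hpmes).pos _ hn0).le]
      exact (measure_union_le _ _).trans_lt (ENNReal.add_lt_add h1 h4)
    · simp only [Set.mem_union, Set.mem_ofPred_eq, not_or, not_lt] at hx
      rcases Finset.mem_insert.1 hj with rfl | hj
      · have hdev := (le_abs_self _).trans (hx.2.trans h3)
        rw [birkhoffAverage, smul_eq_mul, sub_le_iff_le_add, inv_mul_le_iff₀ hn0] at hdev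
        rwa [add_comm]
      · exact h2 x hx.1 j hj

/-- The Birkhoff sums of the truncated function `log max(‖A⁽ᴺ⁾‖, r)` satisfy a one-sided large
deviation estimate: a layer cake decomposition bounds the function from above by finitely many
indicators of sets in `ℱ_N(A)`, and compatibility bounds these by observables. -/
theorem exists_birkhoffSum_log_max_le [IsProbabilityMeasure μ] {Ξ : Set (X → ℝ)} {S : LDTSetting} {m : ℕ} {A : X → Matrix (Fin m) (Fin m) ℝ}
    (hcomp : Compatible μ T Ξ A) (hLDT : ∀ ξ ∈ Ξ, BaseLDT μ T S ξ) {N : ℕ}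
    (hmeas : Measurable fun x => ‖iterate T A N x‖) {b : ℝ}
    (hb : ∀ᵐ x ∂μ, ‖iterate T A N x‖ ≤ b) {r : ℝ} (hr : 0 < r) {η : ℝ} (hη : 0 < η) :
    ∃ n₀ : ℕ, ∃ mes ∈ S.mesFuns, ∃ E : ℕ → Set X, ∀ n, 1 ≤ n → n₀ ≤ n →
      μ (E n) < ENNReal.ofReal (mes n) ∧
        ∀ x ∉ E n, (∀ j, ‖iterate T A N (T^[j] x)‖ ≤ b) →
          ∑ j ∈ Finset.range n, Real.log (max ‖iterate T A N (T^[j] x)‖ r) ≤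
            n * (∫ y, Real.log (max ‖iterate T A N y‖ r) ∂μ + 3 * η) := by
  obtain ⟨k, hk⟩ := exists_nat_ge ((Real.log (max b r) - Real.log r) / η)
  have hlayers : ∀ x, ‖iterate T A N x‖ ≤ b →
      Real.log (max ‖iterate T A N x‖ r) ≤ Real.log r + η * k := fun x hx => by
    rw [div_le_iff₀ hη] at hk
    have := Real.log_le_log (lt_max_of_lt_right hr) (max_le_max_right r hx)
    linarith
  set F : ℕ → Set X := fun i => {x | r * Real.exp ((i + 1) * η) ≤ ‖iterate T A N x‖} with hF
  have hFm : ∀ i, MeasurableSet (F i) := fun i => measurableSet_le measurable_const hmeas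
  have hind : ∀ (i : ℕ) x, (if r * Real.exp ((i + 1) * η) ≤ ‖iterate T A N x‖ then (1 : ℝ) else 0) =
      (F i).indicator (fun _ => (1 : ℝ)) x := fun i x => rfl
  -- `k` errors of size `ε` add up to at most `1`.
  set ε : ℝ := 1 / (k + 1) with hε
  have hε0 : 0 < ε := by positivity
  have hkε : k * ε ≤ 1 := by
    rw [hε, mul_one_div, div_le_one (by positivity)]
    linarith
  choose ξ hξ hξF _ hξint using fun i : ℕ => hcomp N (F i)
    (setOf_le_norm_iterate_mem_cocycleAlgebra T A N (by positivity)) ε hε0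
  obtain ⟨n₀, mes, hmes, E, hE⟩ := exists_birkhoffSum_le_of_baseLDT (μ := μ) (T := T)
    (Finset.range k) (fun i _ => hLDT _ (hξ i)) hε0
  have hint : Real.log r + η * ∑ i ∈ Finset.range k, μ.real (F i) ≤
      ∫ y, Real.log (max ‖iterate T A N y‖ r) ∂μ := by
    have hFi : ∀ i, Integrable ((F i).indicator fun _ => (1 : ℝ)) μ := fun i =>
      (integrable_const _).indicator (hFm i)
    have hsum : Integrable
        (fun x => ∑ i ∈ Finset.range k, (F i).indicator (fun _ => (1 : ℝ)) x) μ :=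
      integrable_finsetSum _ fun i _ => hFi i
    calc _ = ∫ x, (Real.log r +
          η * ∑ i ∈ Finset.range k, (F i).indicator (fun _ => (1 : ℝ)) x) ∂μ := by
          rw [integral_add (integrable_const _) (hsum.const_mul η), integral_const_mul,
            integral_finsetSum _ fun i _ => hFi i]
          simp [integral_indicator_const _ (hFm _)]
      _ ≤ _ := by
          refine integral_mono_ae ((integrable_const _).add (hsum.const_mul η))
            (integrable_log_max hmeas hr hb) ?_
          filter_upwards [hb] with x hx
          have := (log_max_layers hr hη (hlayers x hx)).1
          simpa only [hind] using this
  refine ⟨n₀, mes, hmes, E, fun n hn hn' => ⟨(hE n hn hn').1, fun x hx hxb => ?_⟩⟩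
  have hup := (hE n hn hn').2 x hx
  have hpt : ∀ j, Real.log (max ‖iterate T A N (T^[j] x)‖ r) ≤
      Real.log r + η + η * ∑ i ∈ Finset.range k, ξ i (T^[j] x) := fun j => by
    refine (log_max_layers hr hη (hlayers _ (hxb j))).2.trans ?_
    simp only [hind]
    gcongr with i _
    exact hξF i _
  calc _ ≤ ∑ j ∈ Finset.range n, (Real.log r + η + η * ∑ i ∈ Finset.range k, ξ i (T^[j] x)) :=
        Finset.sum_le_sum fun j _ => hpt j
    _ = n * (Real.log r + η) + η * ∑ i ∈ Finset.range k, birkhoffSum T (ξ i) n x := by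
        rw [Finset.sum_add_distrib, ← Finset.mul_sum, Finset.sum_comm]
        simp [birkhoffSum, mul_add]
    _ ≤ n * (Real.log r + η) +
          η * ∑ i ∈ Finset.range k, n * (μ.real (F i) + ε + ε) := by
        gcongr with i hi
        exact (hup i hi).trans (by gcongr; exact hξint i)
    _ = n * ((Real.log r + η * ∑ i ∈ Finset.range k, μ.real (F i)) +
          (η + 2 * (η * (k * ε)))) := by
        rw [← Finset.mul_sum, Finset.sum_add_distrib, Finset.sum_add_distrib, Finset.sum_const,
          Finset.card_range, nsmul_eq_mul]
        ring
    _ ≤ _ := by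
        have := mul_le_mul_of_nonneg_left hkε hη.le
        gcongr
        linarith

/-! ### Uniform upper bounds near a cocycle -/

/-- Any real number above `L₁(A)`, which may be `-∞`, is off a small set an upper bound for the
growth rates of all cocycles near `A`. -/
theorem exists_growth_le_of_topExponent_lt [IsProbabilityMeasure μ] (hT : MeasurePreserving T μ μ)
    (C : CocycleSpace μ) {Ξ : Set (X → ℝ)} {S : LDTSetting} {m : ℕ}
    {A : X → Matrix (Fin m) (Fin m) ℝ} (hA : A ∈ C.carrier m)
    (hcomp : Compatible μ T Ξ A) (hLDT : ∀ ξ ∈ Ξ, BaseLDT μ T S ξ) {a : ℝ}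
    (ha : topExponent μ T A < a) :
    ∃ δ : ℝ, 0 < δ ∧ ∃ n₀ : ℕ, 1 ≤ n₀ ∧ ∃ mes ∈ S.mesFuns, ∃ E : ℕ → Set X,
      ∀ B ∈ C.carrier m, C.dist B A < δ → ∀ n : ℕ, n₀ ≤ n →
        ∃ E' : Set X, E' =ᵐ[μ] E n ∧ μ E' < ENNReal.ofReal (mes n) ∧
          ∀ x, x ∉ E' → growth T B n x ≤ (a : EReal) := by
  obtain ⟨N, hNa, hN⟩ := ((eventually_lt_of_limsup_lt ha).and (eventually_ge_atTop 1)).exists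
  have hN0 : (0 : ℝ) < N := by exact_mod_cast hN
  have hmeas := measurable_norm_iterate hT.measurable (C.measurable m A hA) N
  -- A bound for the cocycles at distance at most `1` from `A`.
  set M : ℝ := (eLpNorm A ∞ μ).toReal + 1 with hM
  have hM1 : 1 ≤ M := le_add_of_nonneg_left ENNReal.toReal_nonneg
  have hM0 : 0 < M := zero_lt_one.trans_le hM1
  have hAM : ∀ᵐ x ∂μ, ‖A x‖ ≤ M - 1 := by
    refine ae_norm_le_of_eLpNorm_top_le (sub_nonneg.2 hM1) ?_
    rw [hM, add_sub_cancel_right, ENNReal.ofReal_toReal (C.bounded m A hA).ne]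
  have hAorb := ae_forall_iterate hT hAM
  have hb : ∀ᵐ x ∂μ, ‖iterate T A N x‖ ≤ M ^ N := by
    filter_upwards [hAorb] with x hx
    exact norm_iterate_le hM0.le (fun j => (hx j).trans (by linarith)) N
  obtain ⟨r, hr, hint⟩ := exists_integral_log_max_lt hN hmeas hb hNa
  -- Of the gap, one fifth is left for the constant `K` below, one for the perturbation and three
  -- for the deviations.
  set η : ℝ := (N * a - ∫ x, Real.log (max ‖iterate T A N x‖ r) ∂μ) / 5 with hη
  have hη0 : 0 < η := div_pos (sub_pos.2 hint) (by norm_num)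
  obtain ⟨n₀, mes, hmes, E, hE⟩ := exists_birkhoffSum_log_max_le hcomp hLDT hmeas hb hr hη0
  set K : ℝ := 2 * (N * N) * Real.log M - N * Real.log r with hK
  obtain ⟨n₁, hn₁⟩ := exists_nat_ge (K / η)
  refine ⟨min 1 (η * r / (N * M ^ N)), lt_min one_pos (by positivity), max (max n₀ n₁) N,
    hN.trans (le_max_right _ _), mes, hmes, E, fun B hB hBA n hn => ?_⟩
  have hn₀ : n₀ ≤ n := (le_max_left _ _).trans ((le_max_left _ _).trans hn)
  have hn₁' : n₁ ≤ n := (le_max_right _ _).trans ((le_max_left _ _).trans hn)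
  have hNn : N ≤ n := (le_max_right _ _).trans hn
  obtain ⟨hEn, hEx⟩ := hE n (hN.trans hNn) hn₀
  set ρ : ℝ := C.dist B A with hρ
  have hρ0 : 0 ≤ ρ := C.dist_nonneg m B hB A hA
  have hρ1 : ρ ≤ 1 := hBA.le.trans (min_le_left _ _)
  have hρη : N * M ^ N * ρ / r ≤ η := by
    rw [div_le_iff₀ hr, ← le_div_iff₀' (by positivity)]
    exact hBA.le.trans (min_le_right _ _)
  have hBAorb := ae_forall_iterate hT
    (ae_norm_le_of_eLpNorm_top_le hρ0 (C.le_dist m A hA B hB))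
  set G : Set X := {x | (∀ j, ‖A (T^[j] x)‖ ≤ M - 1) ∧
    ∀ j, ‖B (T^[j] x) - A (T^[j] x)‖ ≤ ρ} with hG
  have hGc : μ Gᶜ = 0 := by
    filter_upwards [hAorb, hBAorb] with x h1 h2 using ⟨h1, h2⟩
  have hunion : (E n ∪ Gᶜ : Set X) =ᵐ[μ] E n := union_ae_eq_left_of_ae_eq_empty
    (ae_eq_empty.2 hGc)
  refine ⟨E n ∪ Gᶜ, hunion, (measure_congr hunion).trans_lt hEn, fun x hx => ?_⟩
  simp only [Set.mem_union, Set.mem_compl_iff, not_or, not_not] at hx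
  obtain ⟨hxE, hxA, hxBA⟩ := hx
  have hxAM : ∀ j, ‖A (T^[j] x)‖ ≤ M := fun j => (hxA j).trans (by linarith)
  have hxBM : ∀ j, ‖B (T^[j] x)‖ ≤ M := fun j => by
    have := norm_add_le (B (T^[j] x) - A (T^[j] x)) (A (T^[j] x))
    rw [sub_add_cancel] at this
    linarith [hxA j, hxBA j]
  have hshift : ∀ i j, T^[j] (T^[i] x) = T^[j + i] x := fun i j =>
    (Function.iterate_add_apply T j i x).symm
  have hxAN : ∀ i, ‖iterate T A N (T^[i] x)‖ ≤ M ^ N := fun i =>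
    norm_iterate_le hM0.le (fun j => hshift i j ▸ hxAM _) N
  have hpert : ∀ i, Real.log (max ‖iterate T B N (T^[i] x)‖ r) ≤
      Real.log (max ‖iterate T A N (T^[i] x)‖ r) + η := fun i => by
    have hdiff : ‖iterate T B N (T^[i] x) - iterate T A N (T^[i] x)‖ ≤ N * M ^ N * ρ :=
      norm_iterate_sub_le hM1 (fun j => hshift i j ▸ hxAM _) (fun j => hshift i j ▸ hxBM _)
        (fun j => hshift i j ▸ hxBA _) N
    have hnorm := (norm_sub_norm_le _ _).trans hdiff
    exact (log_max_le_log_max_add hr (sub_le_iff_le_add'.1 hnorm) (by positivity)).trans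
      (by gcongr)
  refine growth_le_of_log_le (hN.trans hNn) fun h0 => ?_
  have hKn : K ≤ n * η := by
    rw [div_le_iff₀ hη0] at hn₁
    refine hn₁.trans ?_
    gcongr
  have hmain : N * Real.log ‖iterate T B n x‖ ≤ N * (n * a) := by
    calc _ ≤ K + ∑ j ∈ Finset.range n, Real.log (max ‖iterate T B N (T^[j] x)‖ r) :=
          mul_log_norm_iterate_le hr hM1 hxBM hN hNn h0
      _ ≤ n * η + ∑ j ∈ Finset.range n,
            (Real.log (max ‖iterate T A N (T^[j] x)‖ r) + η) :=
          add_le_add hKn (Finset.sum_le_sum fun j _ => hpert j)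
      _ ≤ n * η + (n * (∫ y, Real.log (max ‖iterate T A N y‖ r) ∂μ + 3 * η) + n * η) := by
          rw [Finset.sum_add_distrib, Finset.sum_const, Finset.card_range, nsmul_eq_mul]
          gcongr
          exact hEx x hxE hxAN
      _ = n * (∫ y, Real.log (max ‖iterate T A N y‖ r) ∂μ + 5 * η) := by ring
      _ = N * (n * a) := by rw [hη]; ring
  exact le_of_mul_le_mul_left hmain hN0

end LyapunovCocycle

open LyapunovCocycle in
theorem proposition2p1 {X : Type*} [MeasurableSpace X] (μ : Measure X) [IsProbabilityMeasure μ]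
    (T : X → X) (hT : Ergodic T μ)
    (C : CocycleSpace μ) (Ξ : Set (X → ℝ)) (hΞ : ∀ ξ ∈ Ξ, Measurable ξ) (S : LDTSetting)
    (m : ℕ) (A : X → Matrix (Fin m) (Fin m) ℝ) (hA : A ∈ C.carrier m)
    (hcomp : Compatible μ T Ξ A) (hLDT : ∀ ξ ∈ Ξ, BaseLDT μ T S ξ) :
    (⊥ < topExponent μ T A → IsL1Bounded μ T A →
      ∀ ε : ℝ, 0 < ε → ∃ δ : ℝ, 0 < δ ∧ ∃ n₀ : ℕ, 1 ≤ n₀ ∧ ∃ mes ∈ S.mesFuns,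
        ∃ E : ℕ → Set X, ∀ B ∈ C.carrier m, C.dist B A < δ → ∀ n : ℕ, n₀ ≤ n →
          ∃ E' : Set X, E' =ᵐ[μ] E n ∧ μ E' < ENNReal.ofReal (mes n) ∧
            ∀ x, x ∉ E' → growth T B n x ≤ topExponent μ T A + (ε : EReal)) ∧
    (topExponent μ T A = ⊥ →
      ∀ t : ℝ, ∃ δ : ℝ, 0 < δ ∧ ∃ n₀ : ℕ, 1 ≤ n₀ ∧ ∃ mes ∈ S.mesFuns,
        ∃ E : ℕ → Set X, ∀ B ∈ C.carrier m, C.dist B A < δ → ∀ n : ℕ, n₀ ≤ n →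
          ∃ E' : Set X, E' =ᵐ[μ] E n ∧ μ E' < ENNReal.ofReal (mes n) ∧
            ∀ x, x ∉ E' → growth T B n x ≤ ((-t : ℝ) : EReal)) := by
  refine ⟨fun hbot hL1 ε hε => ?_, fun hbot t => ?_⟩
  · have htop := topExponent_lt_top_of_isL1Bounded hL1
    lift topExponent μ T A to ℝ using ⟨htop.ne, hbot.ne'⟩ with L hL
    have hlt : topExponent μ T A < ((L + ε : ℝ) : EReal) := by
      rw [← hL]
      exact_mod_cast lt_add_of_pos_right L hε
    exact_mod_cast exists_growth_le_of_topExponent_lt hT.toMeasurePreserving C hA hcomp hLDT hlt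
  · exact exists_growth_le_of_topExponent_lt hT.toMeasurePreserving C hA hcomp hLDT
      (hbot ▸ EReal.bot_lt_coe _)
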